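/- Let $G$ be a directed acyclic graph (DAG) on a finite set $V$ of variables. A quasi-path is a path in the skeleton (the underlying undirected graph), i.e. a sequence of distinct, consecutively adjacent vertices. A set $S\subseteq V$ blocks a quasi-path if the quasi-path has consecutive vertices $a,c,b$ such that either $c\in S$ and $c$ is not a collider (i.e. not $a\to c\leftarrow b$), or $a\to c\leftarrow b$ and no descendant of $c$ ($c$ itself included) is in $S$. For distinct $i,j\in V$ and $S\subseteq V\setminus\{i,j\}$, the set $S$ d-separates $i$ from $j$ if it blocks every quasi-path from $i$ to $j$. Two DAGs on the same vertex set are Markov equivalent if they have the same d-separations $(i,j,S)$; $\mathrm{MEC}(G)$ is the set of all DAGs on $V$ that are Markov equivalent to $G$. A singleton intervention on $t\in V$ yields the interventional DAG $G^{(t)}$ on $V\cup\{W_t\}$, where $W_t$ is a new vertex: the edge $W_t\to t$ is added and, if the intervention is hard, all edges of $G$ into $t$ are removed; if it is soft, all edges of $G$ are kept. Fix for every $t\in V$ whether the intervention on $t$ is hard or soft. For a target set $\mathcal I\subseteq V$, let $\mathcal I\text{-}\mathrm{MEC}(G)$ be the set of all $G'\in\mathrm{MEC}(G)$ such that $G'^{(t)}$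 is Markov equivalent to $G^{(t)}$ for every $t\in\mathcal I$. The essential graph of $G$ and its $\mathcal I$-essential graph are the graphs on $V$ whose edge sets are the unions of the edge sets of the members of $\mathrm{MEC}(G)$ and of $\mathcal I\text{-}\mathrm{MEC}(G)$, respectively; an edge $(u,v)$ of such a graph is directed if $(v,u)$ is not an edge of it. Let $R(\mathcal I,G)$ be the set of edges that are directed in the $\mathcal I$-essential graph but not directed in the essential graph. Then for all subsets $\mathcal I_1,\mathcal I_2\subseteq V$, \[ R(\mathcal I_1\cup\mathcal I_2,G)=R(\mathcal I_1,G)\cup R(\mathcal I_2,G). \] -/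

import Mathlib

/-- A directed acyclic graph on the vertex set `V`: no vertex is reachable from itself along a
nonempty directed walk (in particular there are no loops and no pairs of opposite edges). -/
structure DAG (V : Type*) extends Digraph V where
  acyclic : ∀ v, ¬ Relation.TransGen Adj v v

namespace DAG

variable {V : Type*}

/-- The skeleton: the undirected graph obtained by forgetting the directions of the edges. -/
def skeleton (G : DAG V) : SimpleGraph V := G.toDigraph.toSimpleGraphInclusive

/-- `G.Desc c d`: there is a directed path from `c` to `d`.
Every vertex is a descendant of itself. -/
def Desc (G : DAG V) (c d : V) : Prop := Relation.ReflTransGen G.Adj c d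

/-- A sequence of vertices (the vertices of a quasi-path, in order) is blocked by `S` if it has
consecutive vertices `a, c, b` such that either `c` is a non-collider in `S`, or `c` is a collider
none of whose descendants (`c` itself included) is in `S`. -/
def Blocked (G : DAG V) (S : Set V) (l : List V) : Prop :=
  ∃ a c b : V, [a, c, b] <:+: l ∧
    ((((G.Adj a c ∧ G.Adj c b) ∨ (G.Adj c a ∧ G.Adj b c) ∨ (G.Adj c a ∧ G.Adj c b)) ∧ c ∈ S) ∨
      ((G.Adj a c ∧ G.Adj b c) ∧ ∀ d, G.Desc c d → d ∉ S))

/-- `S` d-separates `i` from `j`: it blocks every quasi-path from `i` to `j`, that is,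
every path from `i` to `j` in the skeleton. -/
def DSep (G : DAG V) (i j : V) (S : Set V) : Prop :=
  ∀ p : G.skeleton.Walk i j, p.IsPath → G.Blocked S p.support

/-- The set of all d-separations of `G`, for distinct vertices `i`, `j` and sets `S`
that contain neither of them. -/
def dSeparations (G : DAG V) : Set (V × V × Set V) :=
  {t | t.1 ≠ t.2.1 ∧ t.1 ∉ t.2.2 ∧ t.2.1 ∉ t.2.2 ∧ G.DSep t.1 t.2.1 t.2.2}

/-- Two DAGs are Markov equivalent if they have the same d-separations. -/
def MarkovEquiv (G H : DAG V) : Prop := G.dSeparations = H.dSeparations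

/-- The two types of interventions. -/
inductive InterventionKind
  | hard
  | soft

/-- The edges of the interventional graph of a singleton intervention on `t`. The vertices of this
graph are those of `G`, as `some v`, and the intervention variable `none`, which is a parent of `t`
and of nothing else. A hard intervention also removes all edges of `G` into `t`. -/
def InterveneAdj (G : DAG V) (k : InterventionKind) (t : V) : Option V → Option V → Prop
  | some u, some v => G.Adj u v ∧ (k = InterventionKind.hard → v ≠ t)
  | none, some v => v = t
  | _, none => False

theorem InterveneAdj.acyclic (G : DAG V) (k : InterventionKind) (t : V) (x : Option V) :
    ¬ Relation.TransGen (G.InterveneAdj k t) x x := by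
  have key : ∀ (u : V) (y : Option V), Relation.TransGen (G.InterveneAdj k t) (some u) y →
      ∃ v, y = some v ∧ Relation.TransGen G.Adj u v := by
    intro u y h
    induction h with
    | @single y h =>
      cases y with
      | none => exact h.elim
      | some v => exact ⟨v, rfl, .single h.1⟩
    | @tail y z _ h ih =>
      obtain ⟨w, rfl, hw⟩ := ih
      cases z with
      | none => exact h.elim
      | some v => exact ⟨v, rfl, hw.tail h.1⟩
  intro h
  cases x with
  | none =>
    obtain ⟨y, _, hy⟩ := Relation.TransGen.tail'_iff.mp h
    cases y <;> exact hy.elim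
  | some u =>
    obtain ⟨v, hv, huv⟩ := key u _ h
    cases hv
    exact G.acyclic u huv

/-- The interventional graph of a singleton intervention of type `k` on the variable `t`. -/
def intervene (G : DAG V) (k : InterventionKind) (t : V) : DAG (Option V) where
  Adj := G.InterveneAdj k t
  acyclic := InterveneAdj.acyclic G k t

/-- The (observational) Markov equivalence class of `G`. -/
def MEC (G : DAG V) : Set (DAG V) := {H | H.MarkovEquiv G}

/-- The interventional Markov equivalence class of `G` for the experiment that consists of the
passive observation and one singleton intervention, of type `k t`, on each `t ∈ I`. -/
def IMEC (k : V → InterventionKind) (I : Set V) (G : DAG V) : Set (DAG V) :=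
  {H | H.MarkovEquiv G ∧ ∀ t ∈ I, (H.intervene (k t) t).MarkovEquiv (G.intervene (k t) t)}

/-- The (interventional) essential graph of a class of DAGs:
its edge set is the union of the edge sets of the members of the class. -/
def essentialGraph (C : Set (DAG V)) : Digraph V where
  Adj u v := ∃ H ∈ C, H.Adj u v

/-- The directed edges of a graph, that is, the edges whose opposite is not an edge. -/
def directedEdges (E : Digraph V) : Set (V × V) :=
  {e | E.Adj e.1 e.2 ∧ ¬ E.Adj e.2 e.1}

/-- `R(I, G)`: the edges that are directed in the interventional essential graph
but not directed in the observational essential graph. -/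
def newlyDirected (k : V → InterventionKind) (I : Set V) (G : DAG V) : Set (V × V) :=
  directedEdges (essentialGraph (IMEC k I G)) \ directedEdges (essentialGraph (MEC G))

end DAG

namespace DAG

variable {V : Type*} {G H : DAG V} {S : Set V} {a b c i j t u v w x y : V}

/-! ### Basic facts -/

/-! An edge `u → v` of `G` is undirected in the essential graph of `I` iff some member of `IMEC k I
G` contains `v → u`. Larger target sets give smaller classes, so the point is
`exists_mem_IMEC_union`: if `u → v` can be reversed under `I₁` and under `I₂`, it can be reversed
under `I₁ ∪ I₂`.

Markov equivalence means same skeleton and same v-structures (`markovEquiv_iff_sameVStructures`).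
One direction uses parent sets as separators, the other a chain of covered-edge reversals. Hence,
for either kind of intervention, `H` lies in the class iff it is equivalent to `G` and every target
has the same parents in both (`mem_IMEC_iff`).

Suppose `H` in the class of `I` reverses `u → v`. Let `A` be the ancestors of `v` that lie strictly
below every target that is an ancestor of `v`. Using `H` inside `A` and `G` elsewhere gives an
equivalent DAG that still reverses `u → v` (`exists_splice`) and changes no parents outside `A`. If
neither of the DAGs for `I₁` and `I₂` serves the union, there are `s ∈ I₂ ∩ A₁` and `t ∈ I₁ ∩ A₂`,
each strictly below the other, a cycle in `G`. -/

theorem not_transGen_self (h : Relation.TransGen G.Adj v v) : False := G.acyclic v h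

theorem asymm (h : G.Adj a b) : ¬ G.Adj b a := fun h' => G.acyclic a (.head h (.single h'))

theorem ne_of_adj (h : G.Adj a b) : a ≠ b := by
  rintro rfl
  exact G.acyclic a (.single h)

theorem skeleton_adj_iff : G.skeleton.Adj a b ↔ G.Adj a b ∨ G.Adj b a := by
  rw [skeleton, Digraph.toSimpleGraphInclusive, SimpleGraph.fromRel_adj]
  exact ⟨fun h => h.2, fun h => ⟨h.elim ne_of_adj fun h' => (ne_of_adj h').symm, h⟩⟩

/-- `v` has a descendant in `S` (`v` itself included). -/
def HasDescIn (G : DAG V) (S : Set V) (v : V) : Prop := ∃ d, G.Desc v d ∧ d ∈ S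

theorem HasDescIn.of_desc (h : G.HasDescIn S v) (hw : G.Desc w v) : G.HasDescIn S w :=
  h.imp fun _ hd => ⟨hw.trans hd.1, hd.2⟩

theorem HasDescIn.of_adj (h : G.HasDescIn S v) (hw : G.Adj w v) : G.HasDescIn S w :=
  h.of_desc (.single hw)

/-! ### Active paths and active walks -/

/-- The consecutive vertices `a, c, b` are passed by a path that is active given `S`. -/
def ActiveTriple (G : DAG V) (S : Set V) (a c b : V) : Prop :=
  (G.Adj a c ∧ G.Adj b c ∧ G.HasDescIn S c) ∨ ((G.Adj c a ∨ G.Adj c b) ∧ c ∉ S)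

theorem not_blocked_cons {l : List V} (hac : G.skeleton.Adj a c) (hcb : G.skeleton.Adj c b) :
    ¬ G.Blocked S (a :: c :: b :: l) ↔ G.ActiveTriple S a c b ∧ ¬ G.Blocked S (c :: b :: l) := by
  rw [skeleton_adj_iff] at hac hcb
  have key : G.ActiveTriple S a c b ↔
      ¬ ((((G.Adj a c ∧ G.Adj c b) ∨ (G.Adj c a ∧ G.Adj b c) ∨ (G.Adj c a ∧ G.Adj c b)) ∧ c ∈ S) ∨
      ((G.Adj a c ∧ G.Adj b c) ∧ ∀ d, G.Desc c d → d ∉ S)) := by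
    have h1 : ¬ (G.Adj a c ∧ G.Adj c a) := fun h => asymm h.1 h.2
    have h2 : ¬ (G.Adj c b ∧ G.Adj b c) := fun h => asymm h.1 h.2
    have h3 : G.HasDescIn S c ↔ ¬ ∀ d, G.Desc c d → d ∉ S := by
      unfold HasDescIn
      push Not
      rfl
    unfold ActiveTriple
    rw [h3]
    tauto
  rw [key, ← not_or, not_iff_not]
  constructor
  · rintro ⟨a', c', b', hl, h⟩
    rcases List.infix_cons_iff.1 hl with hl | hl
    · simp only [List.cons_prefix_cons, List.nil_prefix, and_true] at hl
      obtain ⟨rfl, rfl, rfl⟩ := hl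
      exact .inl h
    · exact .inr ⟨a', c', b', hl, h⟩
  · rintro (h | ⟨a', c', b', hl, h⟩)
    · exact ⟨a, c, b, ⟨[], l, rfl⟩, h⟩
    · exact ⟨a', c', b', List.infix_cons hl, h⟩

theorem not_blocked_pair : ¬ G.Blocked S [a, b] := by
  rintro ⟨a', c', b', hl, -⟩
  simpa using hl.length_le

theorem not_blocked_singleton : ¬ G.Blocked S [a] := by
  rintro ⟨a', c', b', hl, -⟩
  simpa using hl.length_le

theorem not_blocked_suffix {l l' : List V} (h : ¬ G.Blocked S l) (hl : l' <:+ l) :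
    ¬ G.Blocked S l' := fun ⟨a, c, b, h1, h2⟩ => h ⟨a, c, b, h1.trans hl.isInfix, h2⟩

/-- `G.ActiveTo S j v f`: there is a walk from `v` to `j` that is active given `S`; the first edge
of the walk points towards `v` if `f` is true, and away from `v` otherwise. -/
inductive ActiveTo (G : DAG V) (S : Set V) (j : V) : V → Bool → Prop
  | refl : ActiveTo G S j j false
  | out {v w : V} {f : Bool} : ActiveTo G S j v f → v ∉ S → G.Adj v w → ActiveTo G S j w true
  | through {v w : V} : ActiveTo G S j v false → v ∉ S → G.Adj w v → ActiveTo G S j w false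
  | collider {v w : V} :
      ActiveTo G S j v true → G.HasDescIn S v → G.Adj w v → ActiveTo G S j w false

theorem activeTo_of_not_blocked (hj : j ∉ S) (l : List V) : ∀ v c : V,
    (v :: c :: l).IsChain G.skeleton.Adj → ¬ G.Blocked S (v :: c :: l) →
    (c :: l).getLast? = some j →
    (G.Adj c v → G.ActiveTo S j v true) ∧ (G.Adj v c → G.ActiveTo S j v false) := by
  induction l with
  | nil =>
    intro v c _ _ hlast
    obtain rfl : c = j := by simpa using hlast
    exact ⟨.out .refl hj, .through .refl hj⟩
  | cons d l ih =>
    intro v c hc hb hlast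
    rw [List.isChain_cons_cons] at hc
    have hcd := (List.isChain_cons_cons.1 hc.2).1
    rw [not_blocked_cons hc.1 hcd] at hb
    obtain ⟨h1, h2⟩ := ih c d hc.2 hb.2 (by simpa using hlast)
    rw [skeleton_adj_iff] at hcd
    obtain ⟨hvc, hdc, hS⟩ | ⟨h, hS⟩ := hb.1
    · exact ⟨fun h => (asymm h hvc).elim, .collider (h1 hdc) hS⟩
    · refine ⟨fun hcv => ?_, fun hvc => ?_⟩
      · rcases hcd with hcd | hdc
        · exact .out (h2 hcd) hS hcv
        · exact .out (h1 hdc) hS hcv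
      · exact .through (h2 (h.resolve_left (asymm hvc))) hS hvc

/-- Cutting an active path at one of its vertices `w`. If the first edge after `w` points towards
`w`, then `w` has a descendant in `S`, or the path up to `w` is directed away from `w`. -/
theorem exists_suffix_of_mem (l : List V) : ∀ v c : V,
    (v :: c :: l).IsChain G.skeleton.Adj → ¬ G.Blocked S (v :: c :: l) → w ∈ c :: l →
    ∃ l', w :: l' <:+ c :: l ∧ ∀ d, l'.head? = some d →
      (G.Adj w d → w ∉ S) ∧ (G.Adj d w → G.HasDescIn S w ∨ (G.Adj c v ∧ G.Desc w v)) := by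
  -- A directed stretch from `w` back along the path either continues to `v` or stops at a collider,
  -- whose descendant in `S` is also one of `w`.
  have step : ∀ (v c d : V) (l : List V), (v :: c :: d :: l).IsChain G.skeleton.Adj →
      ¬ G.Blocked S (v :: c :: d :: l) →
      (G.Adj c d → c ∉ S) ∧
      (G.Adj d c → G.Desc w c → G.HasDescIn S w ∨ (G.Adj c v ∧ G.Desc w v)) := by
    intro v c d l hc hb
    rw [List.isChain_cons_cons] at hc
    have hcd := (List.isChain_cons_cons.1 hc.2).1
    rw [not_blocked_cons hc.1 hcd] at hb
    refine ⟨fun hcd' => ?_, fun hdc hwc => ?_⟩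
    · obtain ⟨-, h, -⟩ | ⟨-, h⟩ := hb.1
      · exact (asymm h hcd').elim
      · exact h
    · rcases skeleton_adj_iff.1 hc.1 with hvc | hcv
      · obtain ⟨-, -, hS⟩ | ⟨h, -⟩ := hb.1
        · exact .inl (hS.of_desc hwc)
        · exact (h.elim (asymm hvc) (asymm hdc)).elim
      · exact .inr ⟨hcv, hwc.tail hcv⟩
  induction l with
  | nil =>
    intro v c hc hb hw
    obtain rfl : w = c := by simpa using hw
    exact ⟨[], List.suffix_rfl, by simp⟩
  | cons d l ih =>
    intro v c hc hb hw
    rcases List.mem_cons.1 hw with rfl | hw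
    · refine ⟨d :: l, List.suffix_rfl, fun d' hd => ?_⟩
      obtain rfl : d = d' := by simpa using hd
      obtain ⟨h1, h2⟩ := step v w d l hc hb
      exact ⟨h1, fun h => h2 h .refl⟩
    · obtain ⟨l', hl', h⟩ := ih c d hc.of_cons (not_blocked_suffix hb (List.suffix_cons _ _)) hw
      refine ⟨l', hl'.trans (List.suffix_cons _ _), fun d' hd => ⟨(h d' hd).1, fun hdw => ?_⟩⟩
      rcases (h d' hd).2 hdw with h | h
      · exact .inl h
      · exact (step v c d l hc hb).2 h.1 h.2

/-- Active walks are shortened to active paths by cutting at a repeated vertex. The cut may change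
the direction of the first edge; the last clause says that this happens only where the next triple
can still be made active. -/
theorem exists_not_blocked_of_activeTo {f : Bool} (h : G.ActiveTo S j v f) :
    ∃ l : List V, (v :: l).IsChain G.skeleton.Adj ∧ (v :: l).Nodup ∧ ¬ G.Blocked S (v :: l) ∧
      (v :: l).getLast? = some j ∧ ∀ c, l.head? = some c →
        (G.Adj v c → f = false ∨ v ∉ S) ∧ (G.Adj c v → f = true ∨ G.HasDescIn S v) := by
  have extend : ∀ (v w : V) (l : List V) (g : Bool), (v :: l).IsChain G.skeleton.Adj →
      (v :: l).Nodup → ¬ G.Blocked S (v :: l) → (v :: l).getLast? = some j →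
      (G.Adj v w ∧ g = true ∨ G.Adj w v ∧ g = false) →
      (∀ c, l.head? = some c → G.ActiveTriple S w v c) →
      (∀ c, l.head? = some c → G.Adj w v → G.Adj c v → G.HasDescIn S v) →
      ∃ l : List V, (w :: l).IsChain G.skeleton.Adj ∧ (w :: l).Nodup ∧ ¬ G.Blocked S (w :: l) ∧
      (w :: l).getLast? = some j ∧ ∀ c, l.head? = some c →
        (G.Adj w c → g = false ∨ w ∉ S) ∧ (G.Adj c w → g = true ∨ G.HasDescIn S w) := by
    intro v w l g hc hn hb hl hg ht hS
    have hwv : G.skeleton.Adj w v := skeleton_adj_iff.2 (hg.elim (.inr ·.1) (.inl ·.1))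
    by_cases hw : w ∈ v :: l
    · rcases List.mem_cons.1 hw with rfl | hw
      · exact (hwv.ne rfl).elim
      · obtain _ | ⟨c, l⟩ := l
        · simp at hw
        · obtain ⟨l', hl', h⟩ := exists_suffix_of_mem l v c hc hb hw
          have hl'' : w :: l' <:+ v :: c :: l := hl'.trans (List.suffix_cons _ _)
          refine ⟨l', hc.suffix hl'', hn.sublist hl''.sublist, not_blocked_suffix hb hl'', ?_, ?_⟩
          · obtain ⟨m, hm⟩ := hl''
            rw [← hm] at hl
            simpa [List.getLast?_append] using hl
          · intro d hd
            refine ⟨fun h' => .inr ((h d hd).1 h'), fun hdw => ?_⟩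
            rcases hg with ⟨-, rfl⟩ | ⟨hwv', rfl⟩
            · exact .inl rfl
            · rcases (h d hd).2 hdw with h | h
              · exact .inr h
              · exact .inr ((hS c rfl hwv' h.1).of_adj hwv')
    · refine ⟨v :: l, List.isChain_cons_cons.2 ⟨hwv, hc⟩, List.nodup_cons.2 ⟨hw, hn⟩, ?_, ?_, ?_⟩
      · obtain _ | ⟨c, l⟩ := l
        · exact not_blocked_pair
        · exact (not_blocked_cons hwv (List.isChain_cons_cons.1 hc).1).2 ⟨ht c rfl, hb⟩
      · simpa using hl
      · intro c hcv
        obtain rfl : v = c := by simpa using hcv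
        rcases hg with ⟨h, rfl⟩ | ⟨h, rfl⟩
        · exact ⟨fun h' => (asymm h h').elim, fun _ => .inl rfl⟩
        · exact ⟨fun _ => .inl rfl, fun h' => (asymm h h').elim⟩
  induction h with
  | refl => exact ⟨[], by simp, by simp, not_blocked_singleton, by simp, by simp⟩
  | @out v w f _ hS hvw ih =>
    obtain ⟨l, hc, hn, hb, hl, h⟩ := ih
    exact extend v w l true hc hn hb hl (.inl ⟨hvw, rfl⟩) (fun _ _ => .inr ⟨.inl hvw, hS⟩)
      fun _ _ h' => (asymm h' hvw).elim
  | @through v w _ hS hwv ih =>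
    obtain ⟨l, hc, hn, hb, hl, h⟩ := ih
    have hS' : ∀ c, l.head? = some c → G.Adj c v → G.HasDescIn S v := fun c hlc hcv =>
      ((h c hlc).2 hcv).resolve_left Bool.false_ne_true
    refine extend v w l false hc hn hb hl (.inr ⟨hwv, rfl⟩) (fun c hlc => ?_)
      fun c hlc _ => hS' c hlc
    obtain _ | ⟨d, l⟩ := l
    · simp at hlc
    · obtain rfl : d = c := by simpa using hlc
      rcases skeleton_adj_iff.1 (List.isChain_cons_cons.1 hc).1 with hd | hd
      · exact .inr ⟨.inr hd, hS⟩
      · exact .inl ⟨hwv, hd, hS' d rfl hd⟩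
  | @collider v w _ hS hwv ih =>
    obtain ⟨l, hc, hn, hb, hl, h⟩ := ih
    refine extend v w l false hc hn hb hl (.inr ⟨hwv, rfl⟩) (fun c hlc => ?_) fun _ _ _ _ => hS
    obtain _ | ⟨d, l⟩ := l
    · simp at hlc
    · obtain rfl : d = c := by simpa using hlc
      rcases skeleton_adj_iff.1 (List.isChain_cons_cons.1 hc).1 with hd | hd
      · exact .inr ⟨.inr hd, ((h d rfl).1 hd).resolve_left Bool.noConfusion⟩
      · exact .inl ⟨hwv, hd, hS⟩

theorem dsep_iff_forall_not_activeTo (hij : i ≠ j) (hj : j ∉ S) :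
    G.DSep i j S ↔ ∀ f, ¬ G.ActiveTo S j i f := by
  constructor
  · intro h f hf
    obtain ⟨l, hc, hn, hb, hl, -⟩ := exists_not_blocked_of_activeTo hf
    have hlast : (i :: l).getLast (by simp) = j := by
      rw [List.getLast?_eq_some_getLast (by simp)] at hl
      simpa using hl
    obtain ⟨p, hp⟩ : ∃ p : G.skeleton.Walk i j, p.support = i :: l := by
      subst hlast
      exact ⟨SimpleGraph.Walk.ofSupport (i :: l) (by simp) hc,
        SimpleGraph.Walk.support_ofSupport _ _⟩
    refine hb (hp ▸ h p ?_)
    rw [SimpleGraph.Walk.isPath_def, hp]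
    exact hn
  · intro h p _
    by_contra hb
    cases p with
    | nil => exact hij rfl
    | @cons _ c _ hic q =>
      have hc := (SimpleGraph.Walk.cons hic q).isChain_adj_support
      obtain ⟨l, hl⟩ : ∃ l, q.support = c :: l := ⟨_, q.cons_tail_support.symm⟩
      rw [SimpleGraph.Walk.support_cons, hl] at hc hb
      have hlast : (c :: l).getLast? = some j := by
        rw [← hl, List.getLast?_eq_some_getLast q.support_ne_nil, q.getLast_support]
      obtain ⟨h1, h2⟩ := activeTo_of_not_blocked hj l i c hc hb hlast
      rcases skeleton_adj_iff.1 hic with h' | h'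
      · exact h _ (h2 h')
      · exact h _ (h1 h')

/-! ### Adjacencies and v-structures -/

/-- Two DAGs have the same adjacencies and the same v-structures. -/
structure SameVStructures (G H : DAG V) : Prop where
  adj_iff : ∀ a b, G.Adj a b ∨ G.Adj b a ↔ H.Adj a b ∨ H.Adj b a
  vStructure_iff : ∀ a c b, a ≠ b → ¬ (G.Adj a b ∨ G.Adj b a) →
    (G.Adj a c ∧ G.Adj b c ↔ H.Adj a c ∧ H.Adj b c)

theorem SameVStructures.refl (G : DAG V) : G.SameVStructures G :=
  ⟨fun _ _ => .rfl, fun _ _ _ _ _ => .rfl⟩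

theorem SameVStructures.symm (h : G.SameVStructures H) : H.SameVStructures G :=
  ⟨fun a b => (h.adj_iff a b).symm, fun a c b hab hn =>
    (h.vStructure_iff a c b hab (by rwa [h.adj_iff])).symm⟩

theorem MarkovEquiv.symm (h : G.MarkovEquiv H) : H.MarkovEquiv G := Eq.symm h

theorem MarkovEquiv.mem_iff (h : G.MarkovEquiv H) : (i, j, S) ∈ G.dSeparations ↔
    (i, j, S) ∈ H.dSeparations := by
  rw [MarkovEquiv] at h
  rw [h]

theorem dsep_parents (hij : i ≠ j) (hadj : ¬ G.Adj i j) (hd : ¬ Relation.TransGen G.Adj j i) :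
    G.DSep i j {p | G.Adj p j} := by
  rw [dsep_iff_forall_not_activeTo (S := {p | G.Adj p j}) hij fun h => ne_of_adj h rfl]
  -- An active walk cannot get past a parent of `j`, and below `j` it cannot turn at a collider,
  -- since a descendant among the parents of `j` would close a cycle.
  have key : ∀ v f, G.ActiveTo {p | G.Adj p j} j v f → (v = j ∧ f = false) ∨
      (f = true ∧ Relation.TransGen G.Adj j v) ∨ (f = false ∧ G.Adj v j) := by
    intro v f h
    induction h with
    | refl => exact .inl ⟨rfl, rfl⟩
    | out _ hS hvw ih =>
      rcases ih with ⟨rfl, -⟩ | ⟨-, h⟩ | ⟨-, h⟩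
      · exact .inr (.inl ⟨rfl, .single hvw⟩)
      · exact .inr (.inl ⟨rfl, h.tail hvw⟩)
      · exact (hS h).elim
    | through _ hS hwv ih =>
      rcases ih with ⟨rfl, -⟩ | ⟨h, -⟩ | ⟨-, h⟩
      · exact .inr (.inr ⟨rfl, hwv⟩)
      · cases h
      · exact (hS h).elim
    | collider _ hS hwv ih =>
      rcases ih with ⟨-, h⟩ | ⟨-, h⟩ | ⟨h, -⟩
      · cases h
      · obtain ⟨d, hd, hdS⟩ := hS
        exact (not_transGen_self ((h.trans_left hd).tail hdS)).elim
      · cases h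
  intro f h
  rcases key i f h with ⟨h, -⟩ | ⟨-, h⟩ | ⟨-, h⟩
  · exact hij h
  · exact hd h
  · exact hadj h

theorem exists_mem_dSeparations (hij : i ≠ j) (hadj : ¬ (G.Adj i j ∨ G.Adj j i)) :
    ∃ S, (i, j, S) ∈ G.dSeparations ∨ (j, i, S) ∈ G.dSeparations := by
  push Not at hadj
  by_cases hd : Relation.TransGen G.Adj j i
  · exact ⟨{p | G.Adj p i}, .inr ⟨hij.symm, hadj.2, fun h => ne_of_adj h rfl,
      dsep_parents hij.symm hadj.2 fun h => not_transGen_self (h.trans hd)⟩⟩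
  · exact ⟨{p | G.Adj p j}, .inl ⟨hij, hadj.1, fun h => ne_of_adj h rfl,
      dsep_parents hij hadj.1 hd⟩⟩

theorem not_mem_dSeparations (hadj : G.Adj i j ∨ G.Adj j i) : (i, j, S) ∉ G.dSeparations := by
  rintro ⟨hij, -, -, h⟩
  have hs := skeleton_adj_iff.2 hadj
  refine not_blocked_pair (h (.cons hs .nil) ?_)
  simpa [SimpleGraph.Walk.isPath_def] using hij

/-- The two-edge path through `c` has to be blocked at `c`, so the d-separations alone reveal
whether `c` is a collider. -/
theorem vStructure_iff_of_mem_dSeparations (h : (a, b, S) ∈ G.dSeparations)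
    (hac : G.Adj a c ∨ G.Adj c a) (hcb : G.Adj c b ∨ G.Adj b c) :
    G.Adj a c ∧ G.Adj b c ↔ c ∉ S := by
  obtain ⟨hab, -, -, h⟩ := h
  have hac' := skeleton_adj_iff.2 hac
  have hcb' := skeleton_adj_iff.2 hcb
  have hb : ¬ G.ActiveTriple S a c b := fun ht =>
    (not_blocked_cons (l := []) hac' hcb').2 ⟨ht, not_blocked_pair⟩
      (h (.cons hac' (.cons hcb' .nil)) (by
        simp [SimpleGraph.Walk.isPath_def, hac'.ne, hcb'.ne]
        exact hab))
  constructor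
  · rintro ⟨h1, h2⟩ hS
    exact hb (.inl ⟨h1, h2, c, .refl, hS⟩)
  · intro hS
    by_contra hn
    refine hb (.inr ⟨?_, hS⟩)
    tauto

theorem MarkovEquiv.sameVStructures (h : G.MarkovEquiv H) : G.SameVStructures H := by
  have hadj : ∀ {G H : DAG V}, G.MarkovEquiv H → ∀ a b, G.Adj a b ∨ G.Adj b a →
      H.Adj a b ∨ H.Adj b a := by
    intro G H h a b hab
    by_contra hn
    have hne : a ≠ b := by
      rintro rfl
      exact hab.elim (fun h => ne_of_adj h rfl) fun h => ne_of_adj h rfl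
    obtain ⟨S, hS | hS⟩ := exists_mem_dSeparations hne hn
    · exact not_mem_dSeparations hab (h.mem_iff.2 hS)
    · exact not_mem_dSeparations hab.symm (h.mem_iff.2 hS)
  have hv : ∀ {G H : DAG V}, G.MarkovEquiv H → ∀ a c b, a ≠ b → ¬ (G.Adj a b ∨ G.Adj b a) →
      G.Adj a c ∧ G.Adj b c → H.Adj a c ∧ H.Adj b c := by
    intro G H h a c b hab hn hc
    have hac := hadj h a c (.inl hc.1)
    have hbc := hadj h b c (.inl hc.2)
    obtain ⟨S, hS | hS⟩ := exists_mem_dSeparations hab hn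
    · rw [vStructure_iff_of_mem_dSeparations (h.mem_iff.1 hS) hac hbc.symm,
        ← vStructure_iff_of_mem_dSeparations hS (.inl hc.1) (.inr hc.2)]
      exact hc
    · refine And.symm ?_
      rw [vStructure_iff_of_mem_dSeparations (h.mem_iff.1 hS) hbc hac.symm,
        ← vStructure_iff_of_mem_dSeparations hS (.inl hc.2) (.inr hc.1)]
      exact hc.symm
  have hadj' : ∀ a b, G.Adj a b ∨ G.Adj b a ↔ H.Adj a b ∨ H.Adj b a :=
    fun a b => ⟨hadj h a b, hadj h.symm a b⟩
  exact ⟨hadj', fun a c b hab hn =>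
    ⟨hv h a c b hab hn, hv h.symm a c b hab (by rwa [← hadj'])⟩⟩

/-! ### Reversing a covered edge -/

/-- The edge `x → y` is covered: apart from `x`, the vertices `x` and `y` have the same parents. -/
def Covered (G : DAG V) (x y : V) : Prop :=
  G.Adj x y ∧ ∀ p, p ≠ x → (G.Adj p y ↔ G.Adj p x)

theorem not_reflTransGen_reverse (hxy : G.Covered x y) (h : Relation.ReflTransGen
    (fun a b => (G.Adj a b ∧ ¬ (a = x ∧ b = y)) ∨ (a = y ∧ b = x)) x w) :
    w ≠ y ∧ Relation.ReflTransGen G.Adj x w := by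
  induction h with
  | refl => exact ⟨ne_of_adj hxy.1, .refl⟩
  | @tail w z _ h ih =>
    obtain ⟨hwz, hn⟩ | ⟨rfl, -⟩ := h
    · refine ⟨?_, ih.2.tail hwz⟩
      rintro rfl
      by_cases hw : w = x
      · exact hn ⟨hw, rfl⟩
      -- A last step into `y` from `w ≠ x` comes from a common parent, which closes a cycle through
      -- `x`.
      · exact not_transGen_self (Relation.TransGen.tail' ih.2 ((hxy.2 w hw).1 hwz))
    · exact (ih.1 rfl).elim

/-- The DAG that results from the reversal of a covered edge. -/
def reverseCovered (G : DAG V) (x y : V) (hxy : G.Covered x y) : DAG V where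
  Adj a b := (G.Adj a b ∧ ¬ (a = x ∧ b = y)) ∨ (a = y ∧ b = x)
  acyclic v h := by
    have key : ∀ w, Relation.TransGen
        (fun a b => (G.Adj a b ∧ ¬ (a = x ∧ b = y)) ∨ (a = y ∧ b = x)) v w →
        Relation.TransGen G.Adj v w ∨ (Relation.ReflTransGen
          (fun a b => (G.Adj a b ∧ ¬ (a = x ∧ b = y)) ∨ (a = y ∧ b = x)) v y ∧
          Relation.ReflTransGen
          (fun a b => (G.Adj a b ∧ ¬ (a = x ∧ b = y)) ∨ (a = y ∧ b = x)) x w) := by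
      intro w h
      induction h with
      | @single w h =>
        obtain h | ⟨rfl, rfl⟩ := h
        · exact .inl (.single h.1)
        · exact .inr ⟨.refl, .refl⟩
      | @tail w z hvw h ih =>
        rcases ih with ih | ih
        · obtain h | ⟨rfl, rfl⟩ := h
          · exact .inl (ih.tail h.1)
          · exact .inr ⟨hvw.to_reflTransGen, .refl⟩
        · exact .inr ⟨ih.1, ih.2.tail h⟩
    rcases key v h with h | h
    · exact G.acyclic v h
    · exact (not_reflTransGen_reverse hxy (h.2.trans h.1)).1 rfl

theorem reverseCovered_adj (hxy : G.Covered x y) : (G.reverseCovered x y hxy).Adj a b ↔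
    (G.Adj a b ∧ ¬ (a = x ∧ b = y)) ∨ (a = y ∧ b = x) := .rfl

theorem covered_reverseCovered (hxy : G.Covered x y) : (G.reverseCovered x y hxy).Covered y x := by
  refine ⟨.inr ⟨rfl, rfl⟩, fun p hp => ?_⟩
  have hne := ne_of_adj hxy.1
  rw [reverseCovered_adj, reverseCovered_adj]
  constructor
  · rintro (⟨h, -⟩ | ⟨rfl, -⟩)
    · exact .inl ⟨(hxy.2 p (ne_of_adj h)).2 h, fun h' => ne_of_adj h h'.1⟩
    · exact (hp rfl).elim
  · rintro (⟨h, h'⟩ | ⟨rfl, -⟩)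
    · exact .inl ⟨(hxy.2 p fun hpx => h' ⟨hpx, rfl⟩).1 h, fun h' => hne h'.2⟩
    · exact (hp rfl).elim

theorem desc_reverseCovered (hxy : G.Covered x y) (hv : v ≠ x) (h : G.Desc v w) :
    (G.reverseCovered x y hxy).Desc v w := by
  induction h with
  | refl => exact .refl
  | @tail w z _ hwz ih =>
    by_cases hw : w = x ∧ z = y
    · obtain ⟨rfl, rfl⟩ := hw
      rcases Relation.ReflTransGen.cases_tail ih with h | ⟨p, hvp, hp⟩
      · exact (hv h.symm).elim
      · rcases hp with ⟨hp, -⟩ | ⟨rfl, -⟩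
        · have hpw := ne_of_adj hp
          exact hvp.tail (.inl ⟨(hxy.2 p hpw).2 hp, fun h => hpw h.1⟩)
        · exact hvp
    · exact ih.tail (.inl ⟨hwz, hw⟩)

theorem hasDescIn_reverseCovered (hxy : G.Covered x y) (hv : v ≠ x) (h : G.HasDescIn S v) :
    (G.reverseCovered x y hxy).HasDescIn S v :=
  h.imp fun _ hd => ⟨desc_reverseCovered hxy hv hd.1, hd.2⟩

theorem hasDescIn_reverseCovered_self (hxy : G.Covered x y) (h : G.HasDescIn S x) :
    (G.reverseCovered x y hxy).HasDescIn S x ∨ (G.reverseCovered x y hxy).HasDescIn S y := by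
  obtain ⟨d, hd, hdS⟩ := h
  rcases Relation.ReflTransGen.cases_head hd with rfl | ⟨z, hz, hzd⟩
  · exact .inl ⟨_, .refl, hdS⟩
  · have h := hasDescIn_reverseCovered hxy (ne_of_adj hz).symm ⟨d, hzd, hdS⟩
    by_cases hzy : z = y
    · exact .inr (hzy ▸ h)
    · exact .inl (h.of_adj (.inl ⟨hz, fun h => hzy h.2⟩))

theorem activeTo_reverseCovered (hxy : G.Covered x y) {f : Bool} (h : G.ActiveTo S j v f) :
    ∃ f, (G.reverseCovered x y hxy).ActiveTo S j v f := by
  have hd := fun v => hasDescIn_reverseCovered (S := S) (v := v) hxy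
  have hdx := hasDescIn_reverseCovered_self (S := S) hxy
  have hK := fun a b => reverseCovered_adj (a := a) (b := b) hxy
  have hG := hxy.2
  have hGxy := hxy.1
  have hG' : ∀ a b, G.Adj a b → ¬ G.Adj b a := fun a b => asymm
  have hG'' : ∀ a, ¬ G.Adj a a := fun a h => ne_of_adj h rfl
  generalize G.reverseCovered x y hxy = K at *
  have out := fun v w f => @ActiveTo.out V K S j v w f
  have through := fun v w => @ActiveTo.through V K S j v w
  have collider := fun v w => @ActiveTo.collider V K S j v w
  have base := @ActiveTo.refl V K S j
  generalize K.ActiveTo S j = A at *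
  -- Off `{x, y}` the walk keeps its flag. A walk reaching `x` from a parent can go to `y` instead,
  -- as parents are shared; the disjunctions list what replaces a walk that uses the edge `x → y`.
  have key : (v ≠ x → v ≠ y → A v f) ∧ (v = x → f = true → A x true ∧ A y true) ∧
      (v = x → f = false → A x false ∨ (A y false ∧ y ∉ S) ∨
        (A x true ∧ A y true ∧ K.HasDescIn S y)) ∧
      (v = y → f = true → (A x true ∧ A y true) ∨ (A x false ∧ x ∉ S) ∨ (A y false ∧ y ∉ S)) ∧
      (v = y → f = false → A y false) := by
    induction h with
    | refl => grind
    | @out v w f _ hS hvw ih =>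
      by_cases hvx : v = x <;> by_cases hvy : v = y <;> by_cases hwx : w = x <;>
        by_cases hwy : w = y <;> cases f <;> grind
    | @through v w _ hS hwv ih =>
      by_cases hvx : v = x <;> by_cases hvy : v = y <;> by_cases hwx : w = x <;>
        by_cases hwy : w = y <;> grind
    | @collider v w _ hS hwv ih =>
      by_cases hvx : v = x <;> by_cases hvy : v = y <;> by_cases hwx : w = x <;>
        by_cases hwy : w = y <;> grind
  by_cases hvx : v = x <;> by_cases hvy : v = y <;> cases f <;> grind

theorem exists_activeTo_reverseCovered_iff (hxy : G.Covered x y) :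
    (∃ f, (G.reverseCovered x y hxy).ActiveTo S j v f) ↔ ∃ f, G.ActiveTo S j v f := by
  refine ⟨fun ⟨f, h⟩ => ?_, fun ⟨f, h⟩ => activeTo_reverseCovered hxy h⟩
  obtain ⟨g, hg⟩ := activeTo_reverseCovered (covered_reverseCovered hxy) h
  have : (G.reverseCovered x y hxy).reverseCovered y x (covered_reverseCovered hxy) = G := by
    have hne := ne_of_adj hxy.1
    have hyx := asymm hxy.1
    obtain ⟨⟨A⟩, hA⟩ := G
    simp only [reverseCovered, DAG.mk.injEq, Digraph.mk.injEq]
    funext a b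
    have h1 := hxy.1
    simp only at h1 hyx
    by_cases ha : a = x <;> by_cases hb : b = y <;> by_cases ha' : a = y <;>
      by_cases hb' : b = x <;> simp_all
  exact ⟨g, this ▸ hg⟩

theorem SameVStructures.reverseCovered (h : G.SameVStructures H) (hxy : G.Covered x y) :
    (G.reverseCovered x y hxy).SameVStructures H := by
  have hadj : ∀ a b, (G.reverseCovered x y hxy).Adj a b ∨ (G.reverseCovered x y hxy).Adj b a ↔
      G.Adj a b ∨ G.Adj b a := by
    intro a b
    simp only [reverseCovered_adj]
    have := hxy.1
    constructor
    · rintro ((h | ⟨rfl, rfl⟩) | (h | ⟨rfl, rfl⟩)) <;> tauto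
    · by_cases h1 : a = x ∧ b = y <;> by_cases h2 : b = x ∧ a = y <;> tauto
  refine ⟨fun a b => (hadj a b).trans (h.adj_iff a b), fun a c b hab hn => ?_⟩
  rw [hadj] at hn
  rw [← h.vStructure_iff a c b hab hn]
  simp only [reverseCovered_adj]
  have hG := hxy.2
  have hG' : ∀ a b, G.Adj a b → ¬ G.Adj b a := fun a b => asymm
  grind

/-- The edges of `G` that are reversed in `H`. -/
def reversedEdges (G H : DAG V) : Set (V × V) := {e | G.Adj e.1 e.2 ∧ H.Adj e.2 e.1}

theorem wellFounded_transGen [Finite V] (G : DAG V) : WellFounded (Relation.TransGen G.Adj) :=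
  have : Std.Irrefl (Relation.TransGen G.Adj) := ⟨G.acyclic⟩
  Finite.wellFounded_of_trans_of_irrefl _

theorem wellFounded_transGen_swap [Finite V] (G : DAG V) :
    WellFounded (Function.swap (Relation.TransGen G.Adj)) :=
  have : Std.Irrefl (Function.swap (Relation.TransGen G.Adj)) := ⟨G.acyclic⟩
  have : IsTrans V (Function.swap (Relation.TransGen G.Adj)) := ⟨fun _ _ _ h h' => h'.trans h⟩
  Finite.wellFounded_of_trans_of_irrefl _

/-- Among reversed edges take the earliest head `y`, then the latest tail `x`. A parent not shared
by `x` and `y` would force a v-structure in only one DAG, a cycle, or a better choice. -/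
theorem SameVStructures.exists_covered [Finite V] (h : G.SameVStructures H)
    (hne : (G.reversedEdges H).Nonempty) : ∃ x y, G.Covered x y ∧ H.Adj y x := by
  obtain ⟨y, ⟨x₀, hx₀⟩, hy⟩ := G.wellFounded_transGen.has_min
    {y | ∃ x, G.Adj x y ∧ H.Adj y x} (let ⟨e, he⟩ := hne; ⟨e.2, e.1, he⟩)
  obtain ⟨x, ⟨hxy, hyx⟩, hx⟩ := G.wellFounded_transGen_swap.has_min
    {x | G.Adj x y ∧ H.Adj y x} ⟨x₀, hx₀⟩
  refine ⟨x, y, ⟨hxy, fun p hp => ⟨fun hpy => ?_, fun hpx => ?_⟩⟩, hyx⟩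
  · by_contra hpx
    by_cases hxp : G.Adj x p
    · have h1 : ¬ H.Adj p x := fun h' => hy p ⟨x, hxp, h'⟩ (.single hpy)
      have h2 : ¬ H.Adj y p := fun h' => hx p ⟨hpy, h'⟩ (.single hxp)
      have h3 := ((h.adj_iff x p).1 (.inl hxp)).resolve_right h1
      have h4 := ((h.adj_iff p y).1 (.inl hpy)).resolve_right h2
      exact H.acyclic x (((Relation.TransGen.single h3).tail h4).tail hyx)
    · exact asymm hyx ((h.vStructure_iff p y x hp (by tauto)).1 ⟨hpy, hxy⟩).2
  · by_contra hpy
    have hyp : ¬ G.Adj y p := fun h' =>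
      G.acyclic y (((Relation.TransGen.single h').tail hpx).tail hxy)
    have hne : p ≠ y := by
      rintro rfl
      exact asymm hxy hpx
    rcases (h.adj_iff p x).1 (.inl hpx) with h' | h'
    · exact asymm hxy ((h.vStructure_iff p x y hne (by tauto)).2 ⟨h', hyx⟩).2
    · exact hy x ⟨p, hpx, h'⟩ (.single hxy)

theorem SameVStructures.exists_activeTo_iff [Finite V] (h : G.SameVStructures H) :
    (∃ f, G.ActiveTo S j v f) ↔ ∃ f, H.ActiveTo S j v f := by
  induction hn : (G.reversedEdges H).ncard using Nat.strong_induction_on generalizing G with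
  | _ n ih =>
    by_cases hne : (G.reversedEdges H).Nonempty
    · obtain ⟨x, y, hxy, hyx⟩ := h.exists_covered hne
      rw [← exists_activeTo_reverseCovered_iff hxy]
      refine ih _ ?_ (h.reverseCovered hxy) rfl
      rw [← hn]
      refine Set.ncard_lt_ncard ⟨?_, fun hs => ?_⟩ (Set.toFinite _)
      · rintro ⟨a, b⟩ ⟨⟨hab, -⟩ | ⟨rfl, rfl⟩, hba⟩
        · exact ⟨hab, hba⟩
        · exact (asymm hyx hba).elim
      · have hmem : (x, y) ∈ G.reversedEdges H := ⟨hxy.1, hyx⟩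
        rcases (hs hmem).1 with h' | h'
        · exact h'.2 ⟨rfl, rfl⟩
        · exact ne_of_adj hxy.1 h'.1
    · have : G = H := by
        obtain ⟨⟨A⟩, hA⟩ := G
        obtain ⟨⟨B⟩, hB⟩ := H
        simp only [DAG.mk.injEq, Digraph.mk.injEq]
        funext a b
        have h1 := h.adj_iff a b
        have h2 : ∀ a b, A a b → ¬ B b a := fun a b ha hb => hne ⟨(a, b), ha, hb⟩
        have h3 := h2 a b
        have h4 := h2 b a
        simp only at h1
        exact propext (by tauto)
      rw [this]

theorem SameVStructures.markovEquiv [Finite V] (h : G.SameVStructures H) : G.MarkovEquiv H := by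
  ext ⟨i, j, S⟩
  refine and_congr_right fun hij => and_congr_right fun _ => and_congr_right fun hj => ?_
  rw [dsep_iff_forall_not_activeTo hij hj, dsep_iff_forall_not_activeTo hij hj, ← not_exists,
    ← not_exists, h.exists_activeTo_iff]

theorem markovEquiv_iff_sameVStructures [Finite V] : G.MarkovEquiv H ↔ G.SameVStructures H :=
  ⟨MarkovEquiv.sameVStructures, SameVStructures.markovEquiv⟩

/-! ### Interventions -/

/-- Hard: `u` and `t` stay adjacent only if `t → u`. Soft: `u → t` forms a v-structure with the
intervention variable. -/
theorem SameVStructures.adj_right_iff_of_intervene {k : InterventionKind}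
    (h : G.SameVStructures H) (ht : (G.intervene k t).SameVStructures (H.intervene k t)) (u : V) :
    G.Adj u t ↔ H.Adj u t := by
  by_cases hut : u = t
  · subst hut
    exact ⟨fun h => (ne_of_adj h rfl).elim, fun h => (ne_of_adj h rfl).elim⟩
  cases k with
  | hard =>
    have h1 : ∀ K : DAG V, (K.intervene .hard t).Adj (some u) (some t) ∨
        (K.intervene .hard t).Adj (some t) (some u) ↔ K.Adj t u := fun K =>
      ⟨fun h => h.elim (fun h => (h.2 rfl rfl).elim) fun h => h.1, fun h => .inr ⟨h, fun _ => hut⟩⟩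
    have h2 := ht.adj_iff (some u) (some t)
    rw [h1, h1] at h2
    have h3 := h.adj_iff u t
    have h4 : G.Adj u t → ¬ G.Adj t u := asymm
    have h5 : H.Adj u t → ¬ H.Adj t u := asymm
    tauto
  | soft =>
    have h1 : ∀ K : DAG V, (K.intervene .soft t).Adj (some u) (some t) ∧
        (K.intervene .soft t).Adj none (some t) ↔ K.Adj u t := fun K =>
      ⟨fun h => h.1.1, fun h => ⟨⟨h, fun h => nomatch h⟩, rfl⟩⟩
    rw [← h1 G, ← h1 H]
    exact ht.vStructure_iff _ _ _ (by simp) fun h => h.elim (fun h => h) hut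

theorem SameVStructures.adj_left_iff (h : G.SameVStructures H)
    (ht : ∀ u, G.Adj u t ↔ H.Adj u t) (u : V) : G.Adj t u ↔ H.Adj t u := by
  have h1 := h.adj_iff u t
  have h2 := ht u
  have h4 : G.Adj u t → ¬ G.Adj t u := asymm
  have h5 : H.Adj u t → ¬ H.Adj t u := asymm
  tauto

theorem SameVStructures.intervene (h : G.SameVStructures H) (k : InterventionKind)
    (ht : ∀ u, G.Adj u t ↔ H.Adj u t) :
    (G.intervene k t).SameVStructures (H.intervene k t) := by
  have ht' : ∀ u, G.Adj t u ↔ H.Adj t u := h.adj_left_iff ht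
  have hadj : ∀ a b, (G.intervene k t).Adj a b ∨ (G.intervene k t).Adj b a ↔
      (H.intervene k t).Adj a b ∨ (H.intervene k t).Adj b a := by
    rintro (_ | a) (_ | b)
    · exact .rfl
    · exact .rfl
    · exact .rfl
    · change (G.Adj a b ∧ _) ∨ (G.Adj b a ∧ _) ↔ (H.Adj a b ∧ _) ∨ (H.Adj b a ∧ _)
      have h1 := h.adj_iff a b
      by_cases ha : a = t
      · subst ha
        rw [ht, ht']
      by_cases hb : b = t
      · subst hb
        rw [ht, ht']
      tauto
  have hv : ∀ {G H : DAG V}, G.SameVStructures H → (∀ u, G.Adj u t ↔ H.Adj u t) →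
      (∀ u, G.Adj t u ↔ H.Adj t u) → ∀ a c b, a ≠ b →
      ¬ ((G.intervene k t).Adj a b ∨ (G.intervene k t).Adj b a) →
      (G.intervene k t).Adj a c ∧ (G.intervene k t).Adj b c →
      (H.intervene k t).Adj a c ∧ (H.intervene k t).Adj b c := by
    intro G H h ht ht' a c b hab hn hc
    obtain _ | c := c
    · cases a <;> exact hc.1.elim
    have hp : ∀ a, c = t → (G.intervene k t).Adj a (some c) →
        (H.intervene k t).Adj a (some c) := by
      rintro (_ | a) rfl hac
      · exact hac
      · exact ⟨(ht a).1 hac.1, hac.2⟩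
    by_cases hct : c = t
    · exact ⟨hp a hct hc.1, hp b hct hc.2⟩
    obtain _ | a := a
    · exact (hct hc.1).elim
    obtain _ | b := b
    · exact (hct hc.2).elim
    have hac : G.Adj a c := hc.1.1
    have hbc : G.Adj b c := hc.2.1
    have hk : ∀ u, H.Adj u c → (H.intervene k t).Adj (some u) (some c) := fun u hu =>
      ⟨hu, fun _ => hct⟩
    have hn' : ∀ {a b}, G.Adj a b → ¬ (G.intervene k t).Adj (some a) (some b) → b = t := by
      intro a b hab hn
      by_contra hb
      exact hn ⟨hab, fun _ => hb⟩
    -- A hard intervention can create a v-structure by deleting `a → t`; the path `a → t → c` in `H`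
    -- then forces `a → c`.
    have hd : ∀ {a b}, G.Adj a b → G.Adj a c → G.Adj b c → b = t → H.Adj a c ∧ H.Adj b c := by
      rintro a b hab hac hbc rfl
      have h1 := (ht' c).1 hbc
      have h2 := (ht a).1 hab
      exact ⟨((h.adj_iff a c).1 (.inl hac)).resolve_right fun h' =>
        H.acyclic a (((Relation.TransGen.single h2).tail h1).tail h'), h1⟩
    push Not at hn
    have : H.Adj a c ∧ H.Adj b c := by
      by_cases h1 : G.Adj a b
      · exact hd h1 hac hbc (hn' h1 hn.1)
      by_cases h2 : G.Adj b a
      · exact (hd h2 hbc hac (hn' h2 hn.2)).symm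
      exact (h.vStructure_iff a c b (fun h => hab (congrArg some h)) (by tauto)).1 ⟨hac, hbc⟩
    exact ⟨hk a this.1, hk b this.2⟩
  refine ⟨hadj, fun a c b hab hn => ⟨hv h ht ht' a c b hab hn, ?_⟩⟩
  rw [hadj] at hn
  exact hv h.symm (fun u => (ht u).symm) (fun u => (ht' u).symm) a c b hab hn

theorem mem_IMEC_iff [Finite V] {k : V → InterventionKind} {I : Set V} :
    H ∈ IMEC k I G ↔ H.SameVStructures G ∧ ∀ t ∈ I, ∀ u, H.Adj u t ↔ G.Adj u t := by
  rw [IMEC, Set.mem_ofPred_eq, markovEquiv_iff_sameVStructures]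
  refine and_congr_right fun h => forall₂_congr fun t _ => ?_
  rw [markovEquiv_iff_sameVStructures]
  exact ⟨h.adj_right_iff_of_intervene, h.intervene (k t)⟩

/-! ### Combining equivalent DAGs -/

/-- If the edges at `t` have the same directions in two equivalent DAGs, then `t` has the same
descendants in both. -/
theorem SameVStructures.transGen_of_adj_iff [Finite V] (h : G.SameVStructures H)
    (ht : ∀ u, G.Adj u t ↔ H.Adj u t) (hy : Relation.TransGen G.Adj t y) :
    Relation.TransGen H.Adj t y := by
  have key : ∀ y, Relation.TransGen G.Adj t y →
      ∃ z, Relation.ReflTransGen G.Adj t z ∧ G.Adj z y ∧ H.Adj z y := by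
    intro y
    induction y using G.wellFounded_transGen.induction with
    | _ y ih =>
      intro hy
      -- With `z` earliest, a preserved edge `z' → z` comes from a vertex not adjacent to `y`;
      -- reversing `z → y` would create the v-structure `z' → z ← y`.
      obtain ⟨z, ⟨htz, hzy⟩, hmin⟩ := G.wellFounded_transGen.has_min
        {z | Relation.ReflTransGen G.Adj t z ∧ G.Adj z y} (Relation.TransGen.tail'_iff.1 hy)
      refine ⟨z, htz, hzy, ?_⟩
      rcases Relation.reflTransGen_iff_eq_or_transGen.1 htz with rfl | htz'
      · exact (h.adj_left_iff ht y).1 hzy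
      · obtain ⟨z', htz', hGz, hHz⟩ := ih z (.single hzy) htz'
        refine ((h.adj_iff z y).1 (.inl hzy)).resolve_right fun hyz => asymm hzy ?_
        refine ((h.vStructure_iff z' z y ?_ ?_).2 ⟨hHz, hyz⟩).2
        · rintro rfl
          exact asymm hzy hGz
        · rintro (h' | h')
          · exact hmin z' ⟨htz', h'⟩ (.single hGz)
          · exact G.acyclic y (((Relation.TransGen.single h').tail hGz).tail hzy)
  induction y using G.wellFounded_transGen.induction with
  | _ y ih =>
    obtain ⟨z, htz, hGz, hHz⟩ := key y hy
    rcases Relation.reflTransGen_iff_eq_or_transGen.1 htz with rfl | htz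
    · exact .single hHz
    · exact (ih z (.single hGz) htz).tail hHz

/-- The edge relation that agrees with `H` on the edges inside `A` and with `G` elsewhere. -/
def SpliceAdj (G H : DAG V) (A : Set V) (a b : V) : Prop :=
  (a ∈ A ∧ b ∈ A ∧ H.Adj a b) ∨ (¬ (a ∈ A ∧ b ∈ A) ∧ G.Adj a b)

/-- The DAG that agrees with `H` on the edges inside a convex set `A` of vertices of `G` and with
`G` elsewhere. -/
def splice (G H : DAG V) (A : Set V) (hA : ∀ a ∈ A, ∀ b ∈ A, ∀ y, Relation.TransGen G.Adj a y →
    Relation.TransGen G.Adj y b → y ∈ A) : DAG V where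
  Adj := G.SpliceAdj H A
  acyclic := by
    -- By convexity, a walk that leaves `A` never returns.
    have h1 : ∀ x ∈ A, ∀ y, Relation.TransGen (G.SpliceAdj H A) x y →
        (y ∈ A ∧ Relation.TransGen H.Adj x y) ∨
        (y ∉ A ∧ ∃ a ∈ A, Relation.TransGen G.Adj a y) := by
      intro x hx y h
      induction h with
      | single h =>
        rcases h with ⟨-, hy, h⟩ | ⟨hn, h⟩
        · exact .inl ⟨hy, .single h⟩
        · exact .inr ⟨fun hy => hn ⟨hx, hy⟩, x, hx, .single h⟩
      | @tail y z _ h ih =>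
        rcases ih with ⟨hy, hxy⟩ | ⟨hy, a, ha, hay⟩
        · rcases h with ⟨-, hz, h⟩ | ⟨hn, h⟩
          · exact .inl ⟨hz, hxy.tail h⟩
          · exact .inr ⟨fun hz => hn ⟨hy, hz⟩, y, hy, .single h⟩
        · rcases h with ⟨hy', -⟩ | ⟨-, h⟩
          · exact (hy hy').elim
          · exact .inr ⟨fun hz => hy (hA a ha z hz y hay (.single h)), a, ha, hay.tail h⟩
    have h2 : ∀ x ∈ A, ¬ Relation.TransGen (G.SpliceAdj H A) x x := by
      intro x hx h
      rcases h1 x hx x h with ⟨-, h⟩ | ⟨h, -⟩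
      · exact H.acyclic x h
      · exact h hx
    have h3 : ∀ x y, Relation.TransGen (G.SpliceAdj H A) x y → Relation.TransGen G.Adj x y ∨
        ∃ a ∈ A, Relation.ReflTransGen (G.SpliceAdj H A) x a ∧
          Relation.TransGen (G.SpliceAdj H A) a y := by
      intro x y h
      induction h with
      | single h =>
        rcases h with ⟨hx, hy, h⟩ | ⟨-, h⟩
        · exact .inr ⟨x, hx, .refl, .single (.inl ⟨hx, hy, h⟩)⟩
        · exact .inl (.single h)
      | @tail y z hxy h ih =>
        rcases ih with ih | ⟨a, ha, hxa, hay⟩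
        · rcases h with ⟨hy, hz, h⟩ | ⟨-, h⟩
          · exact .inr ⟨y, hy, hxy.to_reflTransGen, .single (.inl ⟨hy, hz, h⟩)⟩
          · exact .inl (ih.tail h)
        · exact .inr ⟨a, ha, hxa, hay.tail h⟩
    intro x h
    rcases h3 x x h with h | ⟨a, ha, hxa, hax⟩
    · exact G.acyclic x h
    · exact h2 a ha (hax.trans_left hxa)

/-- By `hA'`, edges of `G` entering `A` from outside keep their direction in `H`, so a v-structure
mixing inner and entering edges is one of `H`. -/
theorem SameVStructures.splice (h : G.SameVStructures H) (A : Set V)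
    (hA : ∀ a ∈ A, ∀ b ∈ A, ∀ y, Relation.TransGen G.Adj a y →
      Relation.TransGen G.Adj y b → y ∈ A)
    (hA' : ∀ a c, G.Adj a c → H.Adj c a → c ∈ A → a ∈ A) :
    (G.splice H A hA).SameVStructures G := by
  have hdef : ∀ a b, (G.splice H A hA).Adj a b ↔
    (a ∈ A ∧ b ∈ A ∧ H.Adj a b) ∨ (¬ (a ∈ A ∧ b ∈ A) ∧ G.Adj a b) := fun _ _ => .rfl
  have hadj : ∀ a b, (G.splice H A hA).Adj a b ∨ (G.splice H A hA).Adj b a ↔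
      G.Adj a b ∨ G.Adj b a := by
    intro a b
    have := h.adj_iff a b
    rw [hdef, hdef]
    tauto
  refine ⟨hadj, fun a c b hab hn => ?_⟩
  rw [hadj] at hn
  have hv := h.vStructure_iff a c b hab hn
  have hac := h.adj_iff a c
  have hbc := h.adj_iff b c
  have ha := hA' a c
  have hb := hA' b c
  have h1 : G.Adj a c → ¬ G.Adj c a := asymm
  have h2 : H.Adj a c → ¬ H.Adj c a := asymm
  have h3 : G.Adj b c → ¬ G.Adj c b := asymm
  have h4 : H.Adj b c → ¬ H.Adj c b := asymm
  rw [hdef, hdef]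
  grind

theorem SameVStructures.exists_splice [Finite V] (h : G.SameVStructures H) {I : Set V}
    (hI : ∀ t ∈ I, ∀ u, G.Adj u t ↔ H.Adj u t) (huv : G.Adj u v) (hvu : H.Adj v u) :
    ∃ (A : Set V) (K : DAG V), K.SameVStructures G ∧ (∀ t ∈ I, ∀ x, K.Adj x t ↔ G.Adj x t) ∧
      (∀ t ∉ A, ∀ x, K.Adj x t ↔ G.Adj x t) ∧ K.Adj v u ∧
      ∀ x ∈ A, G.Desc x v ∧ ∀ t ∈ I, G.Desc t v → Relation.TransGen G.Adj t x := by
  have hdesc : ∀ t ∈ I, ∀ x, Relation.TransGen G.Adj t x ↔ Relation.TransGen H.Adj t x :=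
    fun t ht x => ⟨h.transGen_of_adj_iff (hI t ht),
      h.symm.transGen_of_adj_iff fun u => (hI t ht u).symm⟩
  let A : Set V := {x | G.Desc x v ∧ ∀ t ∈ I, G.Desc t v → Relation.TransGen G.Adj t x}
  have hA : ∀ a ∈ A, ∀ b ∈ A, ∀ y, Relation.TransGen G.Adj a y →
      Relation.TransGen G.Adj y b → y ∈ A := fun a ha b hb y hay hyb =>
    ⟨hyb.to_reflTransGen.trans hb.1, fun t ht htv => (ha.2 t ht htv).trans hay⟩
  -- A target has the same descendants in `G` and `H`, so being below it passes along the reversed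
  -- edge `c → a`.
  have hA' : ∀ a c, G.Adj a c → H.Adj c a → c ∈ A → a ∈ A := fun a c hac hca hc =>
    ⟨.head hac hc.1, fun t ht htv =>
      (hdesc t ht a).2 (((hdesc t ht c).1 (hc.2 t ht htv)).tail hca)⟩
  have hv : v ∈ A := by
    refine ⟨.refl, fun t ht htv => ?_⟩
    rcases Relation.reflTransGen_iff_eq_or_transGen.1 htv with rfl | htv
    -- `v` is no target, since its parent `u` is lost in `H`.
    · exact (asymm hvu ((hI _ ht u).1 huv)).elim
    · exact htv
  have hu : u ∈ A := hA' u v huv hvu hv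
  refine ⟨A, G.splice H A hA, h.splice A hA hA', fun t ht x => ?_, fun t ht x => ?_,
    .inl ⟨hv, hu, hvu⟩, fun x hx => hx⟩
  · have := hI t ht x
    change (x ∈ A ∧ t ∈ A ∧ H.Adj x t) ∨ (¬ (x ∈ A ∧ t ∈ A) ∧ G.Adj x t) ↔ _
    tauto
  · change (x ∈ A ∧ t ∈ A ∧ H.Adj x t) ∨ (¬ (x ∈ A ∧ t ∈ A) ∧ G.Adj x t) ↔ _
    tauto

theorem exists_mem_IMEC_union [Finite V] {k : V → InterventionKind} {I₁ I₂ : Set V}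
    (huv : G.Adj u v) (h₁ : ∃ H ∈ IMEC k I₁ G, H.Adj v u) (h₂ : ∃ H ∈ IMEC k I₂ G, H.Adj v u) :
    ∃ H ∈ IMEC k (I₁ ∪ I₂) G, H.Adj v u := by
  simp only [mem_IMEC_iff] at *
  obtain ⟨H₁, ⟨hH₁, hI₁⟩, hvu₁⟩ := h₁
  obtain ⟨H₂, ⟨hH₂, hI₂⟩, hvu₂⟩ := h₂
  obtain ⟨A₁, K₁, hK₁, hKI₁, hKA₁, hKvu₁, hA₁⟩ :=
    hH₁.symm.exists_splice (fun t ht u => (hI₁ t ht u).symm) huv hvu₁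
  obtain ⟨A₂, K₂, hK₂, hKI₂, hKA₂, hKvu₂, hA₂⟩ :=
    hH₂.symm.exists_splice (fun t ht u => (hI₂ t ht u).symm) huv hvu₂
  by_cases hd₁ : ∃ t ∈ I₂, t ∈ A₁
  · by_cases hd₂ : ∃ t ∈ I₁, t ∈ A₂
    · obtain ⟨s, hs, hsA⟩ := hd₁
      obtain ⟨t, ht, htA⟩ := hd₂
      exact (not_transGen_self (((hA₁ s hsA).2 t ht (hA₂ t htA).1).trans
        ((hA₂ t htA).2 s hs (hA₁ s hsA).1))).elim
    · refine ⟨K₂, ⟨hK₂, ?_⟩, hKvu₂⟩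
      rintro t (ht | ht)
      · exact hKA₂ t fun h => hd₂ ⟨t, ht, h⟩
      · exact hKI₂ t ht
  · refine ⟨K₁, ⟨hK₁, ?_⟩, hKvu₁⟩
    rintro t (ht | ht)
    · exact hKI₁ t ht
    · exact hKA₁ t fun h => hd₁ ⟨t, ht, h⟩

theorem mem_directedEdges_IMEC_iff [Finite V] {k : V → InterventionKind} {I : Set V} :
    (u, v) ∈ directedEdges (essentialGraph (IMEC k I G)) ↔
      G.Adj u v ∧ ¬ ∃ H ∈ IMEC k I G, H.Adj v u := by
  constructor
  · rintro ⟨⟨H, hH, huv⟩, hn⟩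
    refine ⟨?_, hn⟩
    refine (((mem_IMEC_iff.1 hH).1.adj_iff u v).1 (.inl huv)).resolve_right fun hvu => hn ?_
    exact ⟨G, mem_IMEC_iff.2 ⟨.refl G, fun _ _ _ => .rfl⟩, hvu⟩
  · rintro ⟨huv, hn⟩
    exact ⟨⟨G, mem_IMEC_iff.2 ⟨.refl G, fun _ _ _ => .rfl⟩, huv⟩, hn⟩

end DAG

theorem mainTheorem3 {V : Type*} [Finite V] (k : V → DAG.InterventionKind) (G : DAG V)
    (I₁ I₂ : Set V) :
    DAG.newlyDirected k (I₁ ∪ I₂) G = DAG.newlyDirected k I₁ G ∪ DAG.newlyDirected k I₂ G := by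
  rw [DAG.newlyDirected, DAG.newlyDirected, DAG.newlyDirected, ← Set.union_sdiff_distrib]
  congr 1
  ext ⟨u, v⟩
  rw [Set.mem_union]
  simp only [DAG.mem_directedEdges_IMEC_iff]
  have hmono : ∀ I ⊆ I₁ ∪ I₂, (∃ H ∈ DAG.IMEC k (I₁ ∪ I₂) G, H.Adj v u) →
      ∃ H ∈ DAG.IMEC k I G, H.Adj v u := fun I hI ⟨H, hH, hvu⟩ =>
    ⟨H, ⟨hH.1, fun t ht => hH.2 t (hI ht)⟩, hvu⟩
  have h₁ := hmono I₁ Set.subset_union_left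
  have h₂ := hmono I₂ Set.subset_union_right
  have h₃ := DAG.exists_mem_IMEC_union (G := G) (k := k) (I₁ := I₁) (I₂ := I₂) (u := u) (v := v)
  rw [← and_or_left, ← not_and_or]
  exact and_congr_right fun huv => not_congr
    ⟨fun h => ⟨h₁ h, h₂ h⟩, fun h => h₃ huv h.1 h.2⟩
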